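/- Let $r\ge 0$, $k\ge 0$ and $m\ge 0$ be integers and let $\beta=(\beta_1,\ldots,\beta_m)$ be a sequence of nonnegative integers. Let $\mathcal{OP}_{r;\beta,k}$ be the set of sequences $\pi=B_1/\cdots/B_k$ of $k$ nonempty finite sets (the blocks) such that the multiset union of the blocks is $\{0^r,1^{\beta_1},\ldots,m^{\beta_m}\}$ and such that $0\notin B_k$ (if $k\ge 1$). For $\pi=B_1/\cdots/B_k\in\mathcal{OP}_{r;\beta,k}$ define three statistics. * $\mathrm{inv}(\pi)$ is the number of pairs of an entry $a$ of a block $B_i$ and the minimum $b=\min B_j$ of a block $B_j$ with $i<j$ and $a>b$ (entries of different blocks are counted separately). * Let $\sigma=\sigma_1\sigma_2\cdots$ be the word obtained by writing the blocks $B_1,\ldots,B_k$ from left to right, each in decreasing order, and let $\mathrm{ind}(\pi)=0^{|B_1|}1^{|B_2|}\cdots(k-1)^{|B_k|}$. Then $\mathrm{maj}(\pi)=\sum_{i:\,\sigma_i>\sigma_{i+1}}\mathrm{ind}(\pi)_{i+1}$. * Let $B_i^h$ be the $h$-th smallest element of $B_i$, for $1\le h\le |B_i|$. Then $\mathrm{dinv}(\pi)$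 is the number of triples $(h,i,j)$ with $i<j$ and $B_i^h>B_j^h$ (primary diagonal inversions) plus the number of triples $(h,i,j)$ with $i<j$ and $B_i^h<B_j^{h+1}$ (secondary diagonal inversions), where only triples for which both entries exist are counted. Then, as polynomials in $q$, $$\sum_{\pi\in\mathcal{OP}_{r;\beta,k}}q^{\mathrm{inv}(\pi)}=\sum_{\pi\in\mathcal{OP}_{r;\beta,k}}q^{\mathrm{maj}(\pi)}=\sum_{\pi\in\mathcal{OP}_{r;\beta,k}}q^{\mathrm{dinv}(\pi)}.$$ -/

import Mathlib

namespace ExtOMP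

/-- The multiset `{0^r} ∪ {1^(β₁), …, m^(β_m)}`; the index `i : Fin m` stands for the letter
`i + 1`. -/
def content (r : ℕ) {m : ℕ} (β : Fin m → ℕ) : Multiset ℕ :=
  Multiset.replicate r 0 + ∑ i : Fin m, Multiset.replicate (β i) ((i : ℕ) + 1)

/-- Extended ordered multiset partitions `B₁ / ⋯ / B_k` of content `β` with `r` zeros and with
`k` blocks. A block is a nonempty finite set (so no letter is repeated inside a block), the blocks
together use every letter with the prescribed multiplicity, and `0` is not in the last block. -/
def OP (r : ℕ) {m : ℕ} (β : Fin m → ℕ) (k : ℕ) : Set (List (Finset ℕ)) :=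
  {π | π.length = k ∧ (∀ B ∈ π, B.Nonempty) ∧ (π.map Finset.val).sum = content r β ∧
    ∀ B ∈ π.getLast?, 0 ∉ B}

theorem OP_finite (r : ℕ) {m : ℕ} (β : Fin m → ℕ) (k : ℕ) : (OP r β k).Finite := by
  refine Set.Finite.subset
    (s := {π : List (Finset ℕ) | π.length = k ∧
      ∀ B ∈ π, B ∈ ((content r β).toFinset.powerset : Set (Finset ℕ))}) ?_ ?_
  · have h := List.finite_length_eq ((content r β).toFinset.powerset) k
    refine (h.image (List.map Subtype.val)).subset ?_
    rintro π ⟨hl, hB⟩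
    refine ⟨π.attach.map (fun B => ⟨B.1, by exact_mod_cast hB B.1 B.2⟩), ?_, ?_⟩
    · simpa using hl
    · simp [List.map_map, Function.comp_def]
  · rintro π ⟨hl, -, hs, -⟩
    refine ⟨hl, fun B hB => ?_⟩
    simp only [Finset.mem_coe, Finset.mem_powerset]
    intro x hx
    rw [Multiset.mem_toFinset, ← hs]
    exact Multiset.mem_of_le (List.single_le_sum (by simp) _ (List.mem_map_of_mem hB)) hx

/-- The generating function `∑ q^(stat π)` over all `π` in `OP r β k`, a polynomial in `q`. -/
noncomputable def D (stat : List (Finset ℕ) → ℕ) (r : ℕ) {m : ℕ} (β : Fin m → ℕ) (k : ℕ) :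
    Polynomial ℤ :=
  ∑ π ∈ (OP_finite r β k).toFinset, Polynomial.X ^ stat π

/-- Pairs `(i, j)` of positions of blocks of `π` with `i < j`. -/
def blockPairs (π : List (Finset ℕ)) : Finset (Fin π.length × Fin π.length) :=
  Finset.univ.filter fun p => p.1 < p.2

/-- The number of pairs `a > b`, where `b` is the minimum of its block and `a` is an entry of a
block strictly to the left of the block of `b`. -/
def inv (π : List (Finset ℕ)) : ℕ :=
  ∑ p ∈ blockPairs π,
    ((π.get p.1 ×ˢ π.get p.2).filter fun ab => ab.1 > ab.2 ∧ ∀ c ∈ π.get p.2, ab.2 ≤ c).card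

/-- The word obtained by writing each block in decreasing order, from left to right. -/
def word (π : List (Finset ℕ)) : List ℕ :=
  π.flatMap fun B => B.sort (fun a b => a ≥ b)

/-- The index word `0^|B₁| 1^|B₂| ⋯ (k-1)^|B_k|`. -/
def ind (π : List (Finset ℕ)) : List ℕ :=
  π.zipIdx.flatMap fun Bi => List.replicate Bi.1.card Bi.2

/-- The sum of `ind_(i+1)` over the descents `σ_i > σ_(i+1)` of `σ = word π`. -/
def maj (π : List (Finset ℕ)) : ℕ :=
  ∑ i ∈ (Finset.range ((word π).length - 1)).filter
      (fun i => (word π).getD i 0 > (word π).getD (i + 1) 0),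
    (ind π).getD (i + 1) 0

/-- `entry B h` is the `(h+1)`-st smallest element of `B`; it is used only for `h < B.card`. -/
def entry (B : Finset ℕ) (h : ℕ) : ℕ := (B.sort (fun a b => a ≤ b)).getD h 0

/-- The number of heights `h` at which `B` (left) has a larger entry than `C` (right), both
entries being present. -/
def primaryDinv (B C : Finset ℕ) : ℕ :=
  ((Finset.range B.card).filter fun h => h < C.card ∧ entry B h > entry C h).card

/-- The number of heights `h` such that the entry of `B` (left) at height `h` is smaller than the
entry of `C` (right) at height `h + 1`, both entries being present. -/
def secondaryDinv (B C : Finset ℕ) : ℕ :=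
  ((Finset.range B.card).filter fun h => h + 1 < C.card ∧ entry B h < entry C (h + 1)).card

/-- The number of primary diagonal inversions plus the number of secondary ones. -/
def dinv (π : List (Finset ℕ)) : ℕ :=
  ∑ p ∈ blockPairs π,
    (primaryDinv (π.get p.1) (π.get p.2) + secondaryDinv (π.get p.1) (π.get p.2))

end ExtOMP

/-!
Fix `x` and consider tuples of `x` possibly empty blocks; deleting the empty blocks leaves a
sequence of `k` nonempty blocks together with their positions in the tuple. Build the tuple letter
by letter in increasing order. If the positions of the nonempty blocks are added to `inv` or to
`dinv`, then inserting a new largest letter adds the ranks of the chosen positions in some linear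
order of all `x` positions. Up to a permutation of the positions this is what happens to
`∑ position * #block`, so the generating function is the same for all three statistics. The order
is the usual one beyond the last nonempty block, so the permutation preserves the last position that
holds a letter, and hence the condition that `0` is not in the last block.

For `maj` the same identity holds among the sequences with a fixed word: if the word has length `n`
and `d` descents, then both sides are the same power of `q` times the `q`-binomial coefficient
`[x + d choose n]`.

The positions of `k` blocks contribute the factor `q ^ (k choose 2) * [x choose k]`. It vanishes
for `x < k` but not for `x = k`, so the identities for all `x` can be solved for the generating
functions with a fixed number of blocks.
-/

namespace ExtOMP

open Finset Polynomial

section QBinomial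

variable {R : Type*} [CommRing R] (q : R)

/-- The Gaussian binomial coefficient `[n choose k]_q`, defined by the `q`-Pascal rule because
Mathlib has no `q`-analogue of `Nat.choose`. -/
def qBinom : ℕ → ℕ → R
  | _, 0 => 1
  | 0, _ + 1 => 0
  | n + 1, k + 1 => q ^ (k + 1) * qBinom n (k + 1) + qBinom n k

@[simp]
theorem qBinom_zero_right (n : ℕ) : qBinom q n 0 = 1 := by
  cases n <;> rw [qBinom]

theorem qBinom_succ_succ (n k : ℕ) :
    qBinom q (n + 1) (k + 1) = q ^ (k + 1) * qBinom q n (k + 1) + qBinom q n k := by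
  rw [qBinom]

theorem qBinom_eq_zero_of_lt {n k : ℕ} (h : n < k) : qBinom q n k = 0 := by
  induction n generalizing k with
  | zero =>
    obtain ⟨k, rfl⟩ := Nat.exists_eq_add_of_lt h
    rw [qBinom]
  | succ n ih =>
    obtain ⟨k, rfl⟩ := Nat.exists_eq_add_one.2 (Nat.zero_lt_of_lt h)
    rw [qBinom_succ_succ, ih (by lia), ih (by lia), mul_zero, add_zero]

@[simp]
theorem qBinom_self (n : ℕ) : qBinom q n n = 1 := by
  induction n with
  | zero => simp
  | succ n ih =>
    rw [qBinom_succ_succ, qBinom_eq_zero_of_lt q n.lt_succ_self, ih, mul_zero, zero_add]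

/-- For `n < k` the exponent is truncated, but then all three coefficients vanish. -/
theorem qBinom_succ_succ' (n k : ℕ) :
    qBinom q (n + 1) (k + 1) = qBinom q n (k + 1) + q ^ (n - k) * qBinom q n k := by
  induction n generalizing k with
  | zero => cases k <;> simp [qBinom_succ_succ, qBinom_eq_zero_of_lt]
  | succ n ih =>
    cases k with
    | zero =>
      have hn := ih 0
      have hpascal := qBinom_succ_succ q n 0
      simp only [zero_add, tsub_zero, pow_one, qBinom_zero_right, mul_one] at hn hpascal
      rw [qBinom_succ_succ]
      simp only [zero_add, tsub_zero, pow_one, qBinom_zero_right, mul_one]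
      linear_combination q * hn - hpascal
    | succ k =>
      have hshift : q * (q ^ (n - (k + 1)) * qBinom q n (k + 1)) =
          q ^ (n - k) * qBinom q n (k + 1) := by
        rcases lt_or_ge k n with h | h
        · rw [← mul_assoc, ← pow_succ', show n - (k + 1) + 1 = n - k by lia]
        · rw [qBinom_eq_zero_of_lt q (by lia), mul_zero, mul_zero, mul_zero]
      rw [Nat.add_sub_add_right]
      linear_combination qBinom_succ_succ q (n + 1) (k + 1) - qBinom_succ_succ q n (k + 1) -
        q ^ (n - k) * qBinom_succ_succ q n k + q ^ (k + 2) * ih (k + 1) + ih k +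
        q ^ (k + 1) * hshift

theorem qBinom_succ_sub_qBinom_succ (n k : ℕ) :
    q ^ (n + 1 - k) * qBinom q (n + 1) k - qBinom q (n + 1) k =
      (q ^ (n + 1) - 1) * qBinom q n k := by
  cases k with
  | zero => simp
  | succ k =>
    have hpow : q ^ (n - k) * (q ^ (k + 1) * qBinom q n (k + 1)) =
        q ^ (n + 1) * qBinom q n (k + 1) := by
      rcases le_or_gt k n with h | h
      · rw [← mul_assoc, ← pow_add, show n - k + (k + 1) = n + 1 by lia]
      · rw [qBinom_eq_zero_of_lt q (by lia), mul_zero, mul_zero, mul_zero]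
    rw [Nat.add_sub_add_right]
    linear_combination
      q ^ (n - k) * qBinom_succ_succ q n k - qBinom_succ_succ' q n k + hpow

theorem pow_mul_qBinom_succ_succ (n k : ℕ) :
    q ^ k * qBinom q (n + 1) (k + 1) = q ^ k * qBinom q n (k + 1) + q ^ n * qBinom q n k := by
  rw [qBinom_succ_succ', mul_add, ← mul_assoc, ← pow_add]
  rcases le_or_gt k n with h | h
  · rw [Nat.add_sub_cancel' h]
  · rw [qBinom_eq_zero_of_lt q h, mul_zero, mul_zero]

/-- The generating function `∑ q ^ (w₁ p₁ + ⋯ + w_k p_k)` of the positions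
`0 ≤ p₁ < ⋯ < p_k < x` that a row of `x` cells offers to objects of weights `w = [w₁, …, w_k]`. The
recursion on `x` asks whether the first object occupies the first cell; the other cells are then
renumbered from `0`, which costs a factor `q ^ w_i` for each object that lies in them. -/
def placements : List ℕ → ℕ → R
  | [], _ => 1
  | _ :: _, 0 => 0
  | a :: w, x + 1 => q ^ (a + w.sum) * placements (a :: w) x + q ^ w.sum * placements w x

@[simp]
theorem placements_nil (x : ℕ) : placements q [] x = 1 := by
  cases x <;> rw [placements]

@[simp]
theorem placements_cons_zero (a : ℕ) (w : List ℕ) : placements q (a :: w) 0 = 0 := by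
  rw [placements]

theorem placements_cons_succ (a : ℕ) (w : List ℕ) (x : ℕ) :
    placements q (a :: w) (x + 1) =
      q ^ (a + w.sum) * placements q (a :: w) x + q ^ w.sum * placements q w x := by
  rw [placements]

theorem placements_replicate_one (k x : ℕ) :
    placements q (List.replicate k 1) x = q ^ k.choose 2 * qBinom q x k := by
  induction x generalizing k with
  | zero => cases k <;> simp [List.replicate_succ, qBinom_eq_zero_of_lt]
  | succ x ih =>
    cases k with
    | zero => simp
    | succ k =>
      rw [List.replicate_succ, placements_cons_succ, ← List.replicate_succ, ih, ih,
        List.sum_replicate, smul_eq_mul, mul_one, qBinom_succ_succ, Nat.choose_succ_succ' k 1,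
        Nat.choose_one_right]
      ring

theorem placements_replicate_one_succ (k x : ℕ) :
    placements q (List.replicate (k + 1) 1) (x + 1) =
      placements q (List.replicate (k + 1) 1) x +
        q ^ x * placements q (List.replicate k 1) x := by
  simp only [placements_replicate_one, Nat.choose_succ_succ' k 1, Nat.choose_one_right]
  linear_combination q ^ k.choose 2 * pow_mul_qBinom_succ_succ q x k

end QBinomial

theorem eq_of_sum_mul_eq_of_triangular {R : Type*} [Ring R] [NoZeroDivisors R] {P : ℕ → ℕ → R}
    (hlower : ∀ k x, x < k → P k x = 0) (hdiag : ∀ k, P k k ≠ 0) {f g : ℕ → R} {n : ℕ}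
    (h : ∀ x, ∑ k ∈ range n, f k * P k x = ∑ k ∈ range n, g k * P k x) {k : ℕ} (hk : k < n) :
    f k = g k := by
  induction k using Nat.strong_induction_on with
  | _ k ih =>
    have hk' := mem_range.2 hk
    have hrest : ∑ j ∈ (range n).erase k, f j * P j k = ∑ j ∈ (range n).erase k, g j * P j k := by
      refine sum_congr rfl fun j hj => ?_
      obtain ⟨hjk, hj⟩ := mem_erase.1 hj
      rcases lt_or_gt_of_ne hjk with hlt | hgt
      · rw [ih j hlt (mem_range.1 hj)]
      · rw [hlower j k hgt, mul_zero, mul_zero]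
    have hsum := h k
    rw [← add_sum_erase _ _ hk', ← add_sum_erase _ _ hk', hrest] at hsum
    exact mul_right_cancel₀ (hdiag k) (add_right_cancel hsum)

section PairSum

variable {α M : Type*} [AddCommMonoid M]

/-- The sum of `f a b` over all pairs of an entry `a` of a list and an entry `b` to its right. -/
def pairSum (f : α → α → M) : List α → M
  | [] => 0
  | a :: l => (l.map (f a)).sum + pairSum f l

theorem pairSum_ofFn (f : α → α → M) {x : ℕ} (c : Fin x → α) :
    pairSum f (List.ofFn c) = ∑ i, ∑ j, if i < j then f (c i) (c j) else 0 := by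
  induction x with
  | zero => simp [pairSum]
  | succ x ih =>
    rw [List.ofFn_succ, pairSum, ih]
    simp [Fin.sum_univ_succ, List.map_ofFn, List.sum_ofFn]

theorem sum_blockPairs (f : Finset ℕ → Finset ℕ → M) (π : List (Finset ℕ)) :
    ∑ p ∈ blockPairs π, f (π.get p.1) (π.get p.2) = pairSum f π := by
  conv_rhs => rw [← List.ofFn_get π]
  rw [pairSum_ofFn, blockPairs, sum_filter, ← univ_product_univ, sum_product]

theorem sum_map_filter_of_eq_zero {g : α → M} {p : α → Bool} (hg : ∀ a, ¬p a → g a = 0)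
    (l : List α) : ((l.filter p).map g).sum = (l.map g).sum := by
  induction l with
  | nil => rfl
  | cons a l ih => by_cases ha : p a <;> simp [ha, ih, hg]

theorem pairSum_filter {f : α → α → M} {p : α → Bool} (hleft : ∀ a b, ¬p a → f a b = 0)
    (hright : ∀ a b, ¬p b → f a b = 0) (l : List α) :
    pairSum f (l.filter p) = pairSum f l := by
  induction l with
  | nil => rfl
  | cons a l ih =>
    by_cases ha : p a
    · rw [List.filter_cons_of_pos ha, pairSum, pairSum, ih, sum_map_filter_of_eq_zero (hright a)]
    · have hzero : f a = fun _ => 0 := funext fun b => hleft a b ha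
      simp [List.filter_cons_of_neg ha, pairSum, ih, hzero]

end PairSum

section NonemptyBlocks

variable {x : ℕ}

/-- The sequence of blocks that remains when the empty blocks of a tuple are deleted. -/
def nonemptyBlocks (c : Fin x → Finset ℕ) : List (Finset ℕ) :=
  (List.ofFn c).filter fun B => B.Nonempty

theorem nonemptyBlocks_cons (B : Finset ℕ) (c : Fin x → Finset ℕ) :
    nonemptyBlocks (Fin.cons B c : Fin (x + 1) → Finset ℕ) =
      if B.Nonempty then B :: nonemptyBlocks c else nonemptyBlocks c := by
  simp only [nonemptyBlocks, List.ofFn_succ, Fin.cons_zero, Fin.cons_succ, List.filter_cons,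
    decide_eq_true_eq]

theorem mem_nonemptyBlocks {c : Fin x → Finset ℕ} {B : Finset ℕ} :
    B ∈ nonemptyBlocks c ↔ (∃ s, c s = B) ∧ B.Nonempty := by
  simp [nonemptyBlocks]

theorem nonemptyBlocks_eq_nil {c : Fin x → Finset ℕ} :
    nonemptyBlocks c = [] ↔ c = fun _ => ∅ := by
  simp [nonemptyBlocks, List.filter_eq_nil_iff, funext_iff]

theorem sum_map_nonemptyBlocks {M : Type*} [AddCommMonoid M] {g : Finset ℕ → M} (hg : g ∅ = 0)
    (c : Fin x → Finset ℕ) : ((nonemptyBlocks c).map g).sum = ∑ s, g (c s) := by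
  rw [nonemptyBlocks, sum_map_filter_of_eq_zero, List.map_ofFn, List.sum_ofFn]
  · rfl
  · simp [hg]

/-- The sum of the positions `0, …, x - 1` of the blocks of a tuple, weighted by `φ`. -/
def position (φ : Finset ℕ → ℕ) (c : Fin x → Finset ℕ) : ℕ :=
  ∑ s, s * φ (c s)

theorem position_cons {φ : Finset ℕ → ℕ} (hφ : φ ∅ = 0) (B : Finset ℕ) (c : Fin x → Finset ℕ) :
    position φ (Fin.cons B c : Fin (x + 1) → Finset ℕ) =
      ((nonemptyBlocks c).map φ).sum + position φ c := by
  rw [sum_map_nonemptyBlocks hφ, position, position, Fin.sum_univ_succ, ← sum_add_distrib]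
  simp only [Fin.cons_zero, Fin.cons_succ, Fin.val_succ, Fin.val_zero, zero_mul, zero_add]
  exact sum_congr rfl fun s _ => by ring

/-- The ways to interleave the blocks of `π` with empty blocks to form a tuple of length `x`. -/
def spreadings : List (Finset ℕ) → (x : ℕ) → Finset (Fin x → Finset ℕ)
  | [], _ => {fun _ => ∅}
  | _ :: _, 0 => ∅
  | B :: π, x + 1 =>
    (spreadings (B :: π) x).map ⟨Fin.cons ∅, Fin.cons_right_injective _⟩ ∪
      (spreadings π x).map ⟨Fin.cons B, Fin.cons_right_injective _⟩

theorem mem_spreadings {π : List (Finset ℕ)} (hπ : ∀ B ∈ π, B.Nonempty) {c : Fin x → Finset ℕ} :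
    c ∈ spreadings π x ↔ nonemptyBlocks c = π := by
  induction x generalizing π with
  | zero => cases π <;> simp [spreadings, nonemptyBlocks, Subsingleton.elim c fun _ => ∅]
  | succ x ih =>
    cases π with
    | nil => rw [spreadings, mem_singleton, nonemptyBlocks_eq_nil]
    | cons B π =>
      obtain ⟨hB, hπ'⟩ := List.forall_mem_cons.1 hπ
      induction c using Fin.consCases with
      | _ C c =>
        simp only [spreadings, mem_union, mem_map, Function.Embedding.coeFn_mk, Fin.cons_inj,
          ih hπ, ih hπ', nonemptyBlocks_cons]
        rcases C.eq_empty_or_nonempty with rfl | hC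
        · simp [hB.ne_empty]
        · simp [hC, hC.ne_empty.symm, eq_comm (a := B), and_comm]

theorem sum_spreadings {R : Type*} [CommRing R] (q : R) {φ : Finset ℕ → ℕ} (hφ : φ ∅ = 0)
    {π : List (Finset ℕ)} (hπ : ∀ B ∈ π, B.Nonempty) (x : ℕ) :
    ∑ c ∈ spreadings π x, q ^ position φ c = placements q (π.map φ) x := by
  induction x generalizing π with
  | zero => cases π <;> simp [spreadings, position]
  | succ x ih =>
    cases π with
    | nil => simp [spreadings, position, hφ]
    | cons B π =>
      obtain ⟨hB, hπ'⟩ := List.forall_mem_cons.1 hπ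
      have hdisj : Disjoint
          ((spreadings (B :: π) x).map ⟨Fin.cons ∅, Fin.cons_right_injective _⟩)
          ((spreadings π x).map ⟨Fin.cons (α := fun _ => Finset ℕ) B,
            Fin.cons_right_injective _⟩) := by
        simp [disjoint_left, hB.ne_empty]
      have hpos : ∀ {ρ : List (Finset ℕ)}, (∀ C ∈ ρ, C.Nonempty) → ∀ C, ∀ c ∈ spreadings ρ x,
          q ^ position φ (Fin.cons C c : Fin (x + 1) → Finset ℕ) =
            q ^ (ρ.map φ).sum * q ^ position φ c := by
        intro ρ hρ C c hc
        rw [position_cons hφ, (mem_spreadings hρ).1 hc, pow_add]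
      rw [spreadings, sum_union hdisj, sum_map, sum_map]
      simp only [Function.Embedding.coeFn_mk]
      rw [sum_congr rfl (hpos hπ ∅), sum_congr rfl (hpos hπ' B), ← mul_sum, ← mul_sum, ih hπ,
        ih hπ', List.map_cons, placements_cons_succ, List.sum_cons]

end NonemptyBlocks

section LargestLetter

/-- The contribution to `inv` of a block `B` and a block `C` to its right. -/
def pairInv (B C : Finset ℕ) : ℕ :=
  #{ab ∈ B ×ˢ C | ab.1 > ab.2 ∧ ∀ c ∈ C, ab.2 ≤ c}

/-- The contribution to `dinv` of a block `B` and a block `C` to its right. -/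
def pairDinv (B C : Finset ℕ) : ℕ := primaryDinv B C + secondaryDinv B C

theorem inv_eq_pairSum (π : List (Finset ℕ)) : inv π = pairSum pairInv π :=
  sum_blockPairs pairInv π

theorem dinv_eq_pairSum (π : List (Finset ℕ)) : dinv π = pairSum pairDinv π :=
  sum_blockPairs pairDinv π

@[simp]
theorem pairInv_empty_left (C : Finset ℕ) : pairInv ∅ C = 0 := by simp [pairInv]

@[simp]
theorem pairInv_empty_right (B : Finset ℕ) : pairInv B ∅ = 0 := by simp [pairInv]

@[simp]
theorem pairDinv_empty_left (C : Finset ℕ) : pairDinv ∅ C = 0 := by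
  simp [pairDinv, primaryDinv, secondaryDinv]

@[simp]
theorem pairDinv_empty_right (B : Finset ℕ) : pairDinv B ∅ = 0 := by
  simp [pairDinv, primaryDinv, secondaryDinv]

theorem pairInv_eq_card {C : Finset ℕ} {b : ℕ} (hb : IsLeast (C : Set ℕ) b) (B : Finset ℕ) :
    pairInv B C = #{a ∈ B | b < a} := by
  have hprod : {ab ∈ B ×ˢ C | ab.1 > ab.2 ∧ ∀ c ∈ C, ab.2 ≤ c} = {a ∈ B | b < a} ×ˢ {b} := by
    ext ⟨u, v⟩
    have hv : v ∈ C ∧ (∀ c ∈ C, v ≤ c) ↔ v = b :=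
      ⟨fun h => IsLeast.unique (s := (C : Set ℕ)) h hb, fun h => h ▸ hb⟩
    simp only [mem_filter, mem_product, mem_singleton, ← hv]
    grind
  rw [pairInv, hprod, card_product, card_singleton, mul_one]

variable {N : ℕ} {B C : Finset ℕ}

theorem pairInv_singleton_of_le (hB : ∀ a ∈ B, a ≤ N) : pairInv B {N} = 0 := by
  rw [pairInv_eq_card (b := N) (by simp), card_eq_zero, filter_eq_empty_iff]
  exact fun a ha => not_lt.2 (hB a ha)

theorem pairInv_insert_right (hC : ∀ a ∈ C, a < N) (hne : C.Nonempty) (B : Finset ℕ) :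
    pairInv B (insert N C) = pairInv B C := by
  have hmin := C.isLeast_min' hne
  rw [pairInv_eq_card hmin, pairInv_eq_card]
  rw [coe_insert]
  simpa [min_eq_right (hC _ hmin.1).le] using hmin.insert N

theorem pairInv_insert_left (hB : ∀ a ∈ B, a < N) (hC : ∀ a ∈ C, a < N) (hne : C.Nonempty) :
    pairInv (insert N B) C = pairInv B C + 1 := by
  have hmin := C.isLeast_min' hne
  have hN : N ∉ {a ∈ B | C.min' hne < a} := fun h => (hB N (mem_filter.1 h).1).false
  rw [pairInv_eq_card hmin, pairInv_eq_card hmin, filter_insert, if_pos (hC _ hmin.1),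
    card_insert_of_notMem hN]

theorem le_of_mem_insert_of_lt (hB : ∀ a ∈ B, a < N) : ∀ a ∈ insert N B, a ≤ N :=
  forall_mem_insert N B _ |>.2 ⟨le_rfl, fun a ha => (hB a ha).le⟩

theorem pairInv_insert (hB : ∀ a ∈ B, a < N) (hC : ∀ a ∈ C, a < N) (p q : Prop) [Decidable p]
    [Decidable q] :
    pairInv (if p then insert N B else B) (if q then insert N C else C) =
      pairInv B C + if p ∧ C.Nonempty then 1 else 0 := by
  rcases C.eq_empty_or_nonempty with rfl | hne
  · by_cases hp : p <;> by_cases hq : q <;>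
      simp [hp, hq, pairInv_singleton_of_le (le_of_mem_insert_of_lt hB),
        pairInv_singleton_of_le fun a ha => (hB a ha).le]
  · by_cases hp : p <;> by_cases hq : q <;>
      simp [hp, hq, hne, pairInv_insert_left hB hC, pairInv_insert_right hC]

theorem notMem_of_forall_lt (hB : ∀ a ∈ B, a < N) : N ∉ B := fun h => (hB N h).false

theorem sort_insert_of_forall_lt (hB : ∀ a ∈ B, a < N) :
    (insert N B).sort (fun a b => a ≤ b) = B.sort (fun a b => a ≤ b) ++ [N] := by
  refine List.Perm.eq_of_pairwise' (r := fun a b : ℕ => a ≤ b) (pairwise_sort _ _) ?_ ?_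
  · simp only [List.pairwise_append, List.mem_singleton, mem_sort, forall_eq]
    exact ⟨pairwise_sort _ _, List.pairwise_singleton _ _, fun a ha => (hB a ha).le⟩
  · rw [← Multiset.coe_eq_coe, sort_eq, ← Multiset.coe_add, sort_eq,
      insert_val_of_notMem (notMem_of_forall_lt hB), add_comm, Multiset.coe_singleton,
      Multiset.singleton_add]

theorem entry_mem {h : ℕ} (hh : h < #B) : entry B h ∈ B := by
  rw [← length_sort (fun a b => a ≤ b)] at hh
  rw [entry, List.getD_eq_getElem _ _ hh]
  exact (mem_sort _).1 (List.getElem_mem hh)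

theorem entry_insert_of_lt_card (hB : ∀ a ∈ B, a < N) {h : ℕ} (hh : h < #B) :
    entry (insert N B) h = entry B h := by
  rw [entry, sort_insert_of_forall_lt hB, List.getD_append _ _ _ _ (by simpa using hh), entry]

theorem entry_insert_card (hB : ∀ a ∈ B, a < N) : entry (insert N B) #B = N := by
  rw [entry, sort_insert_of_forall_lt hB, List.getD_append_right _ _ _ _ (by simp)]
  simp

theorem card_filter_range_succ (p : ℕ → Prop) [DecidablePred p] (n : ℕ) :
    #{h ∈ range (n + 1) | p h} = #{h ∈ range n | p h} + if p n then 1 else 0 := by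
  simp only [card_filter, sum_range_succ]

theorem primaryDinv_insert_left (hB : ∀ a ∈ B, a < N) (hC : ∀ a ∈ C, a < N) :
    primaryDinv (insert N B) C = primaryDinv B C + if #B < #C then 1 else 0 := by
  rw [primaryDinv, card_insert_of_notMem (notMem_of_forall_lt hB), card_filter_range_succ,
    entry_insert_card hB]
  congr 1
  · refine congrArg card (filter_congr fun h hh => ?_)
    rw [entry_insert_of_lt_card hB (mem_range.1 hh)]
  · exact if_congr (and_iff_left_of_imp fun h => hC _ (entry_mem h)) rfl rfl

theorem primaryDinv_insert_right (hB : ∀ a ∈ B, a ≤ N) (hC : ∀ a ∈ C, a < N) :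
    primaryDinv B (insert N C) = primaryDinv B C := by
  refine congrArg card (filter_congr fun h hh => ?_)
  rw [card_insert_of_notMem (notMem_of_forall_lt hC)]
  rcases lt_trichotomy h #C with hlt | rfl | hgt
  · simp [entry_insert_of_lt_card hC hlt, hlt, hlt.le]
  · simp [entry_insert_card hC, hB _ (entry_mem (mem_range.1 hh))]
  · simp [hgt.not_gt, hgt.not_ge]

theorem secondaryDinv_insert_left (hB : ∀ a ∈ B, a < N) (hC : ∀ a ∈ C, a ≤ N) :
    secondaryDinv (insert N B) C = secondaryDinv B C := by
  rw [secondaryDinv, card_insert_of_notMem (notMem_of_forall_lt hB), card_filter_range_succ,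
    entry_insert_card hB, if_neg, add_zero]
  · refine congrArg card (filter_congr fun h hh => ?_)
    rw [entry_insert_of_lt_card hB (mem_range.1 hh)]
  · exact fun h => (hC _ (entry_mem h.1)).not_gt h.2

theorem secondaryDinv_insert_right (hB : ∀ a ∈ B, a < N) (hC : ∀ a ∈ C, a < N) :
    secondaryDinv B (insert N C) = secondaryDinv B C + if 0 < #C ∧ #C ≤ #B then 1 else 0 := by
  have hnew : ∀ h ∈ range #B, (h + 1 < #(insert N C) ∧ entry B h < entry (insert N C) (h + 1)) ↔
      (h + 1 < #C ∧ entry B h < entry C (h + 1)) ∨ h + 1 = #C := by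
    intro h hh
    rw [card_insert_of_notMem (notMem_of_forall_lt hC)]
    rcases lt_trichotomy (h + 1) #C with hlt | heq | hgt
    · simp [entry_insert_of_lt_card hC hlt, hlt, hlt.ne, hlt.le]
    · simp [heq, entry_insert_card hC, hB _ (entry_mem (mem_range.1 hh))]
    · simp [hgt.not_gt, hgt.not_ge, hgt.ne']
  have hdisj : Disjoint {h ∈ range #B | h + 1 < #C ∧ entry B h < entry C (h + 1)}
      {h ∈ range #B | h + 1 = #C} :=
    disjoint_filter.2 fun _ _ hlt heq => hlt.1.ne heq
  rw [secondaryDinv, filter_congr hnew, filter_or, card_union_of_disjoint hdisj, ← secondaryDinv]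
  congr 1
  split_ifs with h
  · refine card_eq_one.2 ⟨#C - 1, ?_⟩
    ext
    simp only [mem_filter, mem_range, mem_singleton]
    lia
  · refine card_eq_zero.2 (filter_eq_empty_iff.2 fun i hi => ?_)
    rw [mem_range] at hi
    lia

theorem pairDinv_insert (hB : ∀ a ∈ B, a < N) (hC : ∀ a ∈ C, a < N) (p q : Prop) [Decidable p]
    [Decidable q] :
    pairDinv (if p then insert N B else B) (if q then insert N C else C) =
      pairDinv B C + (if p ∧ #B < #C then 1 else 0) +
        if q ∧ 0 < #C ∧ #C ≤ #B then 1 else 0 := by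
  unfold pairDinv
  by_cases hp : p <;> by_cases hq : q <;>
    simp only [hp, hq, if_true, if_false, true_and, false_and, add_zero]
  · rw [primaryDinv_insert_right (le_of_mem_insert_of_lt hB) hC, primaryDinv_insert_left hB hC,
      secondaryDinv_insert_left hB (le_of_mem_insert_of_lt hC), secondaryDinv_insert_right hB hC]
    ring
  · rw [primaryDinv_insert_left hB hC, secondaryDinv_insert_left hB fun a ha => (hC a ha).le]
    ring
  · rw [primaryDinv_insert_right (fun a ha => (hB a ha).le) hC, secondaryDinv_insert_right hB hC]
    ring

end LargestLetter

section InsertionStatistic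

variable {x : ℕ}

/-- The tuple obtained by adding the letter `N` to the blocks at the positions in `T`. -/
def insertAt (N : ℕ) (T : Finset (Fin x)) (c : Fin x → Finset ℕ) : Fin x → Finset ℕ :=
  fun s => if s ∈ T then insert N (c s) else c s

@[simp]
theorem mem_insertAt {N a : ℕ} {T : Finset (Fin x)} {c : Fin x → Finset ℕ} {s : Fin x} :
    a ∈ insertAt N T c s ↔ s ∈ T ∧ a = N ∨ a ∈ c s := by
  by_cases hs : s ∈ T <;> simp [insertAt, hs]

/-- `I` is an insertion statistic if inserting a new largest letter at the positions in `T` adds to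
`I` the sum of the ranks of these positions, for some ordering `ρ` of all positions. The ordering
may depend on the tuple, but beyond the last nonempty block it has to be the usual one. -/
def IsInsertionStat (I : (Fin x → Finset ℕ) → ℕ) : Prop :=
  I (fun _ => ∅) = 0 ∧ ∀ (N : ℕ) (c : Fin x → Finset ℕ), (∀ s, ∀ a ∈ c s, a < N) →
    ∃ ρ : Equiv.Perm (Fin x), (∀ T, I (insertAt N T c) = I c + ∑ s ∈ T, (ρ s : ℕ)) ∧
      ∀ s, (∀ t, s ≤ t → c t = ∅) → ρ s = s

theorem exists_perm_rank {α : Type*} [LinearOrder α] {key : Fin x → α}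
    (hkey : Function.Injective key) :
    ∃ ρ : Equiv.Perm (Fin x), ∀ s, (ρ s : ℕ) = #{t | key t < key s} := by
  have hmono : StrictMono (key ∘ Tuple.sort key) :=
    (Tuple.monotone_sort key).strictMono_of_injective (hkey.comp (Tuple.sort key).injective)
  refine ⟨(Tuple.sort key).symm, fun s => ?_⟩
  have hmap : ({t | key t < key s} : Finset (Fin x)) =
      (Iio ((Tuple.sort key).symm s)).map (Tuple.sort key).toEmbedding := by
    ext t
    simpa using (hmono.lt_iff_lt (a := (Tuple.sort key).symm t) (b := (Tuple.sort key).symm s))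
  rw [hmap, card_map, Fin.card_Iio]

theorem sum_sum_lt_add_ite (g : Fin x → Fin x → ℕ) (T : Finset (Fin x))
    (L R : Fin x → Fin x → Prop) [DecidableRel L] [DecidableRel R] :
    (∑ i, ∑ j, if i < j then
        g i j + (if i ∈ T ∧ L i j then 1 else 0) + (if j ∈ T ∧ R i j then 1 else 0) else 0) =
      (∑ i, ∑ j, if i < j then g i j else 0) +
        ∑ s ∈ T, #{t | (s < t ∧ L s t) ∨ (t < s ∧ R t s)} := by
  have hsplit : ∀ i j : Fin x, (if i < j then
        g i j + (if i ∈ T ∧ L i j then 1 else 0) + (if j ∈ T ∧ R i j then 1 else 0) else 0) =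
      (if i < j then g i j else 0) + (if i ∈ T then if i < j ∧ L i j then 1 else 0 else 0) +
        if j ∈ T then if i < j ∧ R i j then 1 else 0 else 0 := by
    intro i j
    by_cases hij : i < j <;> simp [hij, ite_and]
  have hcard : ∀ s, #{t | (s < t ∧ L s t) ∨ (t < s ∧ R t s)} =
      (∑ t, if s < t ∧ L s t then 1 else 0) + ∑ t, if t < s ∧ R t s then 1 else 0 := by
    intro s
    rw [← card_filter, ← card_filter, filter_or, card_union_of_disjoint]
    exact disjoint_filter.2 fun t _ hst hts => lt_asymm hst.1 hts.1
  have hmem : ∀ F : Fin x → ℕ, ∑ s ∈ T, F s = ∑ s, if s ∈ T then F s else 0 := by simp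
  simp_rw [hsplit, hcard, sum_add_distrib, hmem, sum_ite_irrel, sum_const_zero, add_assoc]
  congr 2
  rw [sum_comm]
  simp_rw [sum_ite_irrel, sum_const_zero]

/-- If the position `t` is said to precede `s` when inserting the new letter at `s` creates a new
contribution to `g` from the pair `{s, t}`, then the rank of `s` is the number of positions that
precede it. The condition on `key` says that this relation is a linear order. -/
theorem isInsertionStat_pairSum {g : Finset ℕ → Finset ℕ → ℕ} {L R : Finset ℕ → Finset ℕ → Prop}
    [DecidableRel L] [DecidableRel R] (hg : g ∅ ∅ = 0) (hL : ∀ B, ¬L B ∅) (hR : ∀ B, R B ∅)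
    (hinsert : ∀ {N : ℕ} {B C : Finset ℕ}, (∀ a ∈ B, a < N) → (∀ a ∈ C, a < N) →
      ∀ (p q : Prop) [Decidable p] [Decidable q],
        g (if p then insert N B else B) (if q then insert N C else C) =
          g B C + (if p ∧ L B C then 1 else 0) + if q ∧ R B C then 1 else 0)
    {α : Type*} [LinearOrder α] {key : (Fin x → Finset ℕ) → Fin x → α}
    (hinj : ∀ c, Function.Injective (key c))
    (hkey : ∀ c s t, key c t < key c s ↔ (s < t ∧ L (c s) (c t)) ∨ (t < s ∧ R (c t) (c s))) :
    IsInsertionStat fun c : Fin x → Finset ℕ => pairSum g (List.ofFn c) := by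
  refine ⟨by simp only [pairSum_ofFn, hg, ite_self, sum_const_zero], fun N c hc => ?_⟩
  obtain ⟨ρ, hρ⟩ := exists_perm_rank (hinj c)
  refine ⟨ρ, fun T => ?_, fun s hs => ?_⟩
  · simp only [pairSum_ofFn, insertAt, hinsert (hc _) (hc _), hρ, hkey]
    exact sum_sum_lt_add_ite (fun i j => g (c i) (c j)) T (fun i j => L (c i) (c j))
      fun i j => R (c i) (c j)
  · have hprec : ∀ t, key c t < key c s ↔ t < s := by
      intro t
      rw [hkey, hs s le_rfl]
      refine ⟨?_, fun h => .inr ⟨h, hR _⟩⟩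
      rintro (⟨hst, hLt⟩ | ⟨hts, -⟩)
      · exact absurd (hs t hst.le ▸ hLt) (hL _)
      · exact hts
    ext
    rw [hρ, ← Fin.card_Iio s]
    congr 1
    ext t
    simp [hprec]

theorem pairSum_add {α : Type*} (f g : α → α → ℕ) (l : List α) :
    pairSum (fun a b => f a b + g a b) l = pairSum f l + pairSum g l := by
  induction l with
  | nil => rfl
  | cons a l ih =>
    simp only [pairSum, ih, List.sum_map_add]
    ring

theorem position_eq_pairSum (φ : Finset ℕ → ℕ) (c : Fin x → Finset ℕ) :
    position φ c = pairSum (fun _ C => φ C) (List.ofFn c) := by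
  rw [pairSum_ofFn, sum_comm, position]
  refine sum_congr rfl fun s _ => ?_
  rw [← sum_filter, sum_const, smul_eq_mul, ← Fin.card_Iio s]
  congr 2
  ext
  simp

/-- The indicator of the nonempty blocks. -/
def occupied (B : Finset ℕ) : ℕ := if B.Nonempty then 1 else 0

/-- The extension of a statistic on sequences of nonempty blocks to tuples of possibly empty
blocks: the positions of the nonempty blocks are added. -/
def shiftedStat (stat : List (Finset ℕ) → ℕ) (c : Fin x → Finset ℕ) : ℕ :=
  stat (nonemptyBlocks c) + position occupied c

theorem shiftedStat_pairSum {f : Finset ℕ → Finset ℕ → ℕ} (hleft : ∀ C, f ∅ C = 0)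
    (hright : ∀ B, f B ∅ = 0) (c : Fin x → Finset ℕ) :
    shiftedStat (pairSum f) c = pairSum (fun B C => f B C + occupied C) (List.ofFn c) := by
  rw [shiftedStat, nonemptyBlocks, pairSum_filter, position_eq_pairSum, ← pairSum_add]
  · intro B C hB
    rw [show B = ∅ by simpa using hB, hleft]
  · intro B C hC
    rw [show C = ∅ by simpa using hC, hright]

theorem occupied_insert (q : Prop) [Decidable q] (N : ℕ) (C : Finset ℕ) :
    occupied (if q then insert N C else C) = occupied C + if q ∧ C = ∅ then 1 else 0 := by
  rcases C.eq_empty_or_nonempty with rfl | hC <;> by_cases hq : q <;>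
    simp_all [occupied, nonempty_iff_ne_empty]

theorem isInsertionStat_position_card :
    IsInsertionStat (position card : (Fin x → Finset ℕ) → ℕ) := by
  simp only [funext (position_eq_pairSum card)]
  refine isInsertionStat_pairSum (L := fun _ _ => False) (R := fun _ _ => True) card_empty
    (fun _ => id) (fun _ => trivial) ?_ (key := fun _ s => s) (fun _ => Function.injective_id)
    (by simp)
  intro N B C _ hC p q _ _
  by_cases hq : q <;> simp [hq, card_insert_of_notMem (notMem_of_forall_lt hC)]

theorem isInsertionStat_shiftedStat_inv :
    IsInsertionStat (shiftedStat inv : (Fin x → Finset ℕ) → ℕ) := by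
  simp only [funext inv_eq_pairSum,
    funext (shiftedStat_pairSum (x := x) pairInv_empty_left pairInv_empty_right)]
  refine isInsertionStat_pairSum (L := fun _ C => C.Nonempty) (R := fun _ C => C = ∅)
    (by simp [occupied]) (by simp) (by simp) ?_
    (key := fun c s => if (c s).Nonempty then -((s : ℕ) + 1 : ℤ) else (s : ℕ)) ?_ ?_
  · intro N B C hB hC p q _ _
    rw [pairInv_insert hB hC, occupied_insert]
    ring
  · intro c s t hst
    dsimp only at hst
    split_ifs at hst <;> exact Fin.ext (by lia)
  · intro c s t
    simp only [← not_nonempty_iff_eq_empty, Fin.lt_def]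
    rcases eq_or_ne s t with rfl | hne
    · simp
    · have := Fin.val_ne_of_ne hne
      split_ifs <;> simp only [*] <;> lia

theorem isInsertionStat_shiftedStat_dinv :
    IsInsertionStat (shiftedStat dinv : (Fin x → Finset ℕ) → ℕ) := by
  simp only [funext dinv_eq_pairSum,
    funext (shiftedStat_pairSum (x := x) pairDinv_empty_left pairDinv_empty_right)]
  refine isInsertionStat_pairSum (L := fun B C => #B < #C) (R := fun B C => #C ≤ #B)
    (by simp [occupied]) (by simp) (by simp) ?_
    (key := fun c s => toLex (OrderDual.toDual #(c s), s)) ?_ ?_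
  · intro N B C hB hC p q _ _
    rw [pairDinv_insert hB hC, occupied_insert]
    simp only [← card_eq_zero]
    split_ifs <;> lia
  · intro c s t hst
    simpa using congrArg (fun p => (ofLex p).2) hst
  · intro c s t
    simp only [Prod.Lex.toLex_lt_toLex, OrderDual.toDual_lt_toDual, OrderDual.toDual_inj]
    rcases lt_trichotomy s t with hst | rfl | hst <;> simp_all <;> lia

end InsertionStatistic

section Equidistribution

variable {x : ℕ}

/-- The number of positions up to the last one in `T`. -/
def endpoint (T : Finset (Fin x)) : ℕ := T.sup fun s => s + 1

/-- The number of positions of `c` up to the last block with a letter less than `M`, as a function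
of `M`. Whether `0` occurs in the last nonempty block can be read off from this function. -/
def profile (c : Fin x → Finset ℕ) (M : ℕ) : ℕ := endpoint {s | ∃ a ∈ c s, a < M}

theorem endpoint_le_iff {T : Finset (Fin x)} {n : ℕ} : endpoint T ≤ n ↔ ∀ s ∈ T, (s : ℕ) < n := by
  simp only [endpoint, Finset.sup_le_iff, Nat.succ_le_iff]

theorem profile_le_iff {c : Fin x → Finset ℕ} {M n : ℕ} :
    profile c M ≤ n ↔ ∀ s, ∀ a ∈ c s, a < M → (s : ℕ) < n := by
  simp [profile, endpoint_le_iff]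

theorem profile_insertAt (N : ℕ) (T : Finset (Fin x)) (c : Fin x → Finset ℕ) :
    profile (insertAt N T c) =
      fun M => if N < M then max (profile c M) (endpoint T) else profile c M := by
  funext M
  refine eq_of_forall_ge_iff fun n => ?_
  by_cases hNM : N < M <;>
    simp only [hNM, if_true, if_false, max_le_iff, profile_le_iff, endpoint_le_iff,
      mem_insertAt] <;>
    grind

theorem max_endpoint_map {ρ : Equiv.Perm (Fin x)} {u : ℕ} (hρ : ∀ s : Fin x, u ≤ s → ρ s = s)
    (T : Finset (Fin x)) : max u (endpoint (T.map ρ.toEmbedding)) = max u (endpoint T) := by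
  have hle : ∀ s : Fin x, u ≤ ρ s ↔ u ≤ s :=
    fun s => ⟨fun h => ρ.injective (hρ _ h) ▸ h, fun h => (hρ s h).symm ▸ h⟩
  refine eq_of_forall_ge_iff fun n => ?_
  simp only [max_le_iff, endpoint_le_iff, forall_mem_map, Equiv.coe_toEmbedding]
  refine and_congr_right fun hn => forall₂_congr fun s _ => ?_
  rcases le_or_gt u s with h | h
  · rw [hρ s h]
  · have := (hle s).not
    lia

/-- The tuples of `x` blocks in which the letters `a < M` have the multiplicities `b a` and no
other letters occur. -/
def tuples (b : ℕ → ℕ) (M x : ℕ) : Finset (Fin x → Finset ℕ) :=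
  {c ∈ Fintype.piFinset fun _ => (range M).powerset | ∀ a < M, #{s | a ∈ c s} = b a}

theorem mem_tuples {b : ℕ → ℕ} {M : ℕ} {c : Fin x → Finset ℕ} :
    c ∈ tuples b M x ↔ (∀ s, ∀ a ∈ c s, a < M) ∧ ∀ a < M, #{s | a ∈ c s} = b a := by
  simp [tuples, subset_iff]

theorem tuples_zero (b : ℕ → ℕ) (x : ℕ) : tuples b 0 x = {fun _ => ∅} := by
  ext c
  simp [mem_tuples, funext_iff, eq_empty_iff_forall_notMem]

theorem insertAt_mem_tuples {b : ℕ → ℕ} {M : ℕ} {T : Finset (Fin x)} {c : Fin x → Finset ℕ}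
    (hc : c ∈ tuples b M x) (hT : #T = b M) : insertAt M T c ∈ tuples b (M + 1) x := by
  rw [mem_tuples] at hc ⊢
  refine ⟨fun s a ha => ?_, fun a ha => ?_⟩
  · rcases mem_insertAt.1 ha with ⟨-, rfl⟩ | ha
    · exact a.lt_succ_self
    · exact (hc.1 s a ha).trans M.lt_succ_self
  · rcases Nat.lt_succ_iff_lt_or_eq.1 ha with ha | rfl
    · simpa [ha.ne] using hc.2 a ha
    · have hnot : ∀ s, a ∉ c s := fun s => notMem_of_forall_lt (hc.1 s)
      simpa [hnot] using hT

theorem erase_mem_tuples {b : ℕ → ℕ} {M : ℕ} {c : Fin x → Finset ℕ}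
    (hc : c ∈ tuples b (M + 1) x) : (fun s => (c s).erase M) ∈ tuples b M x := by
  rw [mem_tuples] at hc ⊢
  refine ⟨fun s a ha => ?_, fun a ha => ?_⟩
  · obtain ⟨hne, ha⟩ := mem_erase.1 ha
    exact Nat.lt_of_le_of_ne (Nat.lt_succ_iff.1 (hc.1 s a ha)) hne
  · simpa [ha.ne] using hc.2 a (ha.trans M.lt_succ_self)

theorem sum_tuples_succ {R : Type*} [AddCommMonoid R] (b : ℕ → ℕ) (M : ℕ)
    (f : (Fin x → Finset ℕ) → R) :
    ∑ c ∈ tuples b (M + 1) x, f c =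
      ∑ c ∈ tuples b M x, ∑ T ∈ powersetCard (b M) univ, f (insertAt M T c) := by
  have hinsert : ∀ c : Fin x → Finset ℕ,
      insertAt M {s | M ∈ c s} (fun s => (c s).erase M) = c := by
    intro c
    ext s a
    simp only [mem_insertAt, mem_filter_univ, mem_erase]
    grind
  rw [← sum_product']
  refine sum_nbij' (fun c => (fun s => (c s).erase M, univ.filter fun s => M ∈ c s))
    (fun p => insertAt M p.2 p.1) ?_ ?_ (fun c _ => hinsert c) ?_ fun c _ => by rw [hinsert c]
  · intro c hc
    exact mem_product.2 ⟨erase_mem_tuples hc,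
      mem_powersetCard_univ.2 ((mem_tuples.1 hc).2 M M.lt_succ_self)⟩
  · rintro ⟨c, T⟩ hcT
    obtain ⟨hc, hT⟩ := mem_product.1 hcT
    exact insertAt_mem_tuples hc (mem_powersetCard_univ.1 hT)
  · rintro ⟨c, T⟩ hcT
    have hM : ∀ s, M ∉ c s := fun s =>
      notMem_of_forall_lt ((mem_tuples.1 (mem_product.1 hcT).1).1 s)
    refine Prod.ext (funext fun s => ?_) (by ext s; simp [hM])
    ext a
    simp only [mem_erase, mem_insertAt]
    grind

variable {R : Type*} [CommSemiring R]

theorem IsInsertionStat.sum_insertAt {I : (Fin x → Finset ℕ) → ℕ} (hI : IsInsertionStat I) {N : ℕ}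
    {c : Fin x → Finset ℕ} (hc : ∀ s, ∀ a ∈ c s, a < N) (q : R) (Ψ : (ℕ → ℕ) → R) (n : ℕ) :
    ∑ T ∈ powersetCard n univ, Ψ (profile (insertAt N T c)) * q ^ I (insertAt N T c) =
      (∑ T ∈ powersetCard n (univ : Finset (Fin x)),
        Ψ (fun M => if N < M then max (profile c M) (endpoint T) else profile c M) *
          q ^ ∑ s ∈ T, (s : ℕ)) * q ^ I c := by
  obtain ⟨ρ, hρ, hfix⟩ := hI.2 N c hc
  have hprofile : ∀ T, profile (insertAt N T c) = fun M =>
      if N < M then max (profile c M) (endpoint (T.map ρ.toEmbedding)) else profile c M := by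
    intro T
    rw [profile_insertAt]
    funext M
    refine if_ctx_congr Iff.rfl (fun hM => (max_endpoint_map (fun s hs => ?_) T).symm) fun _ => rfl
    refine hfix s fun t hst => eq_empty_of_forall_notMem fun a ha => ?_
    exact (profile_le_iff.1 hs t a ha ((hc t a ha).trans hM)).not_ge hst
  rw [sum_mul]
  refine sum_equiv (Equiv.finsetCongr ρ) (by simp) fun T _ => ?_
  rw [hprofile, hρ, Equiv.finsetCongr_apply, sum_map, pow_add, mul_assoc, mul_comm (q ^ I c)]
  rfl

theorem IsInsertionStat.sum_eq {I J : (Fin x → Finset ℕ) → ℕ} (hI : IsInsertionStat I)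
    (hJ : IsInsertionStat J) (b : ℕ → ℕ) (M : ℕ) (q : R) (Ψ : (ℕ → ℕ) → R) :
    ∑ c ∈ tuples b M x, Ψ (profile c) * q ^ I c = ∑ c ∈ tuples b M x, Ψ (profile c) * q ^ J c := by
  induction M generalizing Ψ with
  | zero => simp [tuples_zero, hI.1, hJ.1]
  | succ M ih =>
    rw [sum_tuples_succ, sum_tuples_succ,
      sum_congr rfl fun c hc => hI.sum_insertAt (mem_tuples.1 hc).1 q Ψ (b M),
      sum_congr rfl fun c hc => hJ.sum_insertAt (mem_tuples.1 hc).1 q Ψ (b M)]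
    exact ih fun p => ∑ T ∈ powersetCard (b M) (univ : Finset (Fin x)),
      Ψ (fun M' => if M < M' then max (p M') (endpoint T) else p M') * q ^ ∑ s ∈ T, (s : ℕ)

end Equidistribution

section Descents

variable {σ ι : List ℕ}

/-- The letter `a` followed by the word `σ` starts with a descent. -/
def HeadLT (σ : List ℕ) (a : ℕ) : Prop := ∃ b ∈ σ.head?, b < a

instance (σ : List ℕ) (a : ℕ) : Decidable (HeadLT σ a) :=
  inferInstanceAs (Decidable (∃ b ∈ σ.head?, b < a))

@[simp]
theorem not_headLT_nil (a : ℕ) : ¬HeadLT [] a := by simp [HeadLT]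

@[simp]
theorem headLT_cons {a b : ℕ} : HeadLT (b :: σ) a ↔ b < a := by simp [HeadLT]

/-- The number of descents of a word. -/
def des : List ℕ → ℕ
  | [] => 0
  | a :: σ => des σ + if HeadLT σ a then 1 else 0

theorem des_lt_length (hσ : σ ≠ []) : des σ < σ.length := by
  induction σ with
  | nil => exact absurd rfl hσ
  | cons a σ ih =>
    cases σ with
    | nil => simp [des]
    | cons b σ =>
      have := ih (List.cons_ne_nil b σ)
      rw [des, List.length_cons]
      split_ifs <;> lia

/-- The sum of the entries of `ι` to the right of the descents of `σ`. It makes `maj` accessible to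
induction on the word. -/
def descentSum (σ ι : List ℕ) : ℕ :=
  ∑ i ∈ range (σ.length - 1) with σ.getD i 0 > σ.getD (i + 1) 0, ι.getD (i + 1) 0

theorem descentSum_cons (a i : ℕ) (σ ι : List ℕ) :
    descentSum (a :: σ) (i :: ι) = descentSum σ ι + if HeadLT σ a then ι.getD 0 0 else 0 := by
  cases σ with
  | nil => simp [descentSum]
  | cons b σ => simp [descentSum, sum_filter, sum_range_succ']

theorem getD_zero_map_succ {a : ℕ} (h : σ.length = ι.length) (ha : HeadLT σ a) :
    (ι.map (· + 1)).getD 0 0 = ι.getD 0 0 + 1 := by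
  cases ι with
  | nil => simp [List.length_eq_zero_iff.1 h] at ha
  | cons j ι => simp

theorem descentSum_map_succ (h : σ.length = ι.length) :
    descentSum σ (ι.map (· + 1)) = descentSum σ ι + des σ := by
  induction σ generalizing ι with
  | nil => simp [descentSum, des]
  | cons a σ ih =>
    obtain ⟨i, ι, rfl⟩ := List.exists_cons_of_length_eq_add_one h.symm
    have h' : σ.length = ι.length := Nat.succ_inj.1 h
    rw [List.map_cons, descentSum_cons, descentSum_cons, des, ih h']
    split_ifs with ha
    · rw [getD_zero_map_succ h' ha]
      ring
    · ring

end Descents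

section Words

variable {a : ℕ} {B : Finset ℕ} {π : List (Finset ℕ)}

theorem word_cons (B : Finset ℕ) (π : List (Finset ℕ)) :
    word (B :: π) = B.sort (fun a b => a ≥ b) ++ word π := by
  simp [word]

theorem word_singleton_cons (a : ℕ) (π : List (Finset ℕ)) : word ({a} :: π) = a :: word π := by
  simp [word_cons]

theorem word_insert_cons (hB : ∀ b ∈ B, b < a) (π : List (Finset ℕ)) :
    word (insert a B :: π) = a :: word (B :: π) := by
  rw [word_cons, sort_insert _ (fun b hb => (hB b hb).le) (notMem_of_forall_lt hB), word_cons,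
    List.cons_append]

theorem word_eq_nil (hπ : ∀ B ∈ π, B.Nonempty) : word π = [] ↔ π = [] := by
  refine ⟨fun h => ?_, fun h => h ▸ rfl⟩
  cases π with
  | nil => rfl
  | cons B π =>
    obtain ⟨b, hb⟩ := hπ B List.mem_cons_self
    rw [word_cons, List.append_eq_nil_iff] at h
    exact absurd ((mem_sort _).2 hb) (h.1 ▸ List.not_mem_nil)

theorem ind_cons (B : Finset ℕ) (π : List (Finset ℕ)) :
    ind (B :: π) = List.replicate #B 0 ++ (ind π).map (· + 1) := by
  simp [ind, List.zipIdx_cons, List.zipIdx_succ, List.flatMap_map, List.map_flatMap]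

theorem length_word (π : List (Finset ℕ)) : (word π).length = (π.map card).sum := by
  induction π with
  | nil => rfl
  | cons B π ih => simp [word_cons, ih]

theorem length_word_eq_length_ind (π : List (Finset ℕ)) :
    (word π).length = (ind π).length := by
  induction π with
  | nil => rfl
  | cons B π ih => simp [word_cons, ind_cons, ih]

theorem maj_eq_descentSum (π : List (Finset ℕ)) : maj π = descentSum (word π) (ind π) := rfl

theorem getD_zero_ind_cons (hB : B.Nonempty) (π : List (Finset ℕ)) :
    (ind (B :: π)).getD 0 0 = 0 := by
  rw [ind_cons, List.getD_append _ _ _ _ (by simpa using hB), List.getD_replicate _ (card_pos.2 hB)]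

theorem getD_zero_ind (hπ : ∀ B ∈ π, B.Nonempty) : (ind π).getD 0 0 = 0 := by
  cases π with
  | nil => rfl
  | cons B π => exact getD_zero_ind_cons (hπ B List.mem_cons_self) π

theorem maj_singleton_cons (a : ℕ) (hπ : ∀ B ∈ π, B.Nonempty) :
    maj ({a} :: π) = maj π + des (a :: word π) := by
  have hlen := length_word_eq_length_ind π
  have hind : ind ({a} :: π) = 0 :: (ind π).map (· + 1) := by simp [ind_cons]
  rw [maj_eq_descentSum, maj_eq_descentSum, word_singleton_cons, hind, descentSum_cons,
    descentSum_map_succ hlen, des, add_assoc]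
  congr 2
  exact if_ctx_congr Iff.rfl
    (fun ha => by rw [getD_zero_map_succ hlen ha, getD_zero_ind hπ]) fun _ => rfl

theorem maj_insert_cons (hne : B.Nonempty) (hB : ∀ b ∈ B, b < a) (π : List (Finset ℕ)) :
    maj (insert a B :: π) = maj (B :: π) := by
  have hind : ind (insert a B :: π) = 0 :: ind (B :: π) := by
    rw [ind_cons, ind_cons, card_insert_of_notMem (notMem_of_forall_lt hB), List.replicate_succ,
      List.cons_append]
  rw [maj_eq_descentSum, maj_eq_descentSum, word_insert_cons hB, hind, descentSum_cons,
    getD_zero_ind_cons hne, ite_self, add_zero]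

theorem headLT_word_cons (hB : B.Nonempty) : HeadLT (word (B :: π)) a ↔ ∀ b ∈ B, b < a := by
  induction B using Finset.induction_on_max with
  | empty => exact absurd rfl hB.ne_empty
  | insert c C hC =>
    rw [word_insert_cons hC, headLT_cons, forall_mem_insert]
    exact ⟨fun hca => ⟨hca, fun b hb => (hC b hb).trans hca⟩, And.left⟩

theorem exists_cons_of_headLT_word (hπ : ∀ B ∈ π, B.Nonempty) (ha : HeadLT (word π) a) :
    ∃ B ρ, π = B :: ρ ∧ B.Nonempty ∧ ∀ b ∈ B, b < a := by
  cases π with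
  | nil => exact absurd ha (not_headLT_nil a)
  | cons B ρ =>
    have hB := hπ B List.mem_cons_self
    exact ⟨B, ρ, rfl, hB, (headLT_word_cons hB).1 ha⟩

end Words

section Cuttings

variable {a : ℕ} {σ : List ℕ} {π : List (Finset ℕ)}

/-- The operation of adding the letter `a` to the first block. -/
def insertHead (a : ℕ) : List (Finset ℕ) → List (Finset ℕ)
  | [] => []
  | B :: π => insert a B :: π

/-- The ways to cut the word `σ` into decreasing runs, that is, the sequences of nonempty blocks
with word `σ`: the first letter is a block of its own or, at a descent, joins the next block. -/
def cuttings : List ℕ → Finset (List (Finset ℕ))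
  | [] => {[]}
  | a :: σ => (cuttings σ).image (List.cons {a}) ∪
      if HeadLT σ a then (cuttings σ).image (insertHead a) else ∅

theorem mem_cuttings_cons : π ∈ cuttings (a :: σ) ↔
    (∃ ρ ∈ cuttings σ, {a} :: ρ = π) ∨ HeadLT σ a ∧ ∃ ρ ∈ cuttings σ, insertHead a ρ = π := by
  rw [cuttings, mem_union, mem_image]
  split_ifs with ha <;> simp [ha]

theorem nonempty_and_word_of_mem_cuttings (hπ : π ∈ cuttings σ) :
    (∀ B ∈ π, B.Nonempty) ∧ word π = σ := by
  induction σ generalizing π with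
  | nil => simp [mem_singleton.1 hπ, word]
  | cons a σ ih =>
    rcases mem_cuttings_cons.1 hπ with ⟨ρ, hρ, rfl⟩ | ⟨ha, ρ, hρ, rfl⟩
    · obtain ⟨hne, rfl⟩ := ih hρ
      exact ⟨List.forall_mem_cons.2 ⟨singleton_nonempty a, hne⟩, word_singleton_cons a ρ⟩
    · obtain ⟨hne, rfl⟩ := ih hρ
      obtain ⟨B, τ, rfl, -, hB⟩ := exists_cons_of_headLT_word hne ha
      exact ⟨List.forall_mem_cons.2 ⟨insert_nonempty a B, (List.forall_mem_cons.1 hne).2⟩,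
        word_insert_cons hB τ⟩

theorem mem_cuttings_word (hπ : ∀ B ∈ π, B.Nonempty) : π ∈ cuttings (word π) := by
  generalize hσ : word π = σ
  induction σ generalizing π with
  | nil => exact mem_singleton.2 ((word_eq_nil hπ).1 hσ)
  | cons a σ ih =>
    cases π with
    | nil => exact absurd hσ (List.cons_ne_nil a σ).symm
    | cons B ρ =>
      obtain ⟨hB, hρ⟩ := List.forall_mem_cons.1 hπ
      induction B using Finset.induction_on_max with
      | empty => exact absurd rfl hB.ne_empty
      | insert c C hC =>
        rw [word_insert_cons hC, List.cons.injEq] at hσ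
        obtain ⟨rfl, hσ⟩ := hσ
        rcases C.eq_empty_or_nonempty with rfl | hne
        · exact mem_cuttings_cons.2 (.inl ⟨ρ, ih hρ (by simpa [word_cons] using hσ), rfl⟩)
        · exact mem_cuttings_cons.2 (.inr ⟨hσ ▸ (headLT_word_cons hne).2 hC, C :: ρ,
            ih (List.forall_mem_cons.2 ⟨hne, hρ⟩) hσ, rfl⟩)

theorem mem_cuttings : π ∈ cuttings σ ↔ (∀ B ∈ π, B.Nonempty) ∧ word π = σ :=
  ⟨nonempty_and_word_of_mem_cuttings, fun h => h.2 ▸ mem_cuttings_word h.1⟩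

theorem sum_map_card_of_mem_cuttings (hπ : π ∈ cuttings σ) : (π.map card).sum = σ.length := by
  rw [← length_word, (mem_cuttings.1 hπ).2]

theorem exists_cons_of_mem_cuttings (ha : HeadLT σ a) (hπ : π ∈ cuttings σ) :
    ∃ B ρ, π = B :: ρ ∧ B.Nonempty ∧ ∀ b ∈ B, b < a := by
  obtain ⟨hne, rfl⟩ := mem_cuttings.1 hπ
  exact exists_cons_of_headLT_word hne ha

theorem exists_cons_of_mem_cuttings_cons (hπ : π ∈ cuttings (a :: σ)) : ∃ B ρ, π = B :: ρ := by
  refine List.exists_cons_of_ne_nil ?_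
  rintro rfl
  exact List.cons_ne_nil a σ (mem_cuttings.1 hπ).2.symm

theorem sum_cuttings_cons_of_not_headLT {M : Type*} [AddCommMonoid M] (ha : ¬HeadLT σ a)
    (f : List (Finset ℕ) → M) :
    ∑ π ∈ cuttings (a :: σ), f π = ∑ π ∈ cuttings σ, f ({a} :: π) := by
  rw [cuttings, if_neg ha, union_empty, sum_image fun _ _ _ _ h => List.tail_eq_of_cons_eq h]

theorem sum_cuttings_cons_of_headLT {M : Type*} [AddCommMonoid M] (ha : HeadLT σ a)
    (f : List (Finset ℕ) → M) :
    ∑ π ∈ cuttings (a :: σ), f π =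
      ∑ π ∈ cuttings σ, f ({a} :: π) + ∑ π ∈ cuttings σ, f (insertHead a π) := by
  have hcons := fun π => exists_cons_of_mem_cuttings (π := π) ha
  have hinj : Set.InjOn (insertHead a) (cuttings σ : Set (List (Finset ℕ))) := by
    intro π hπ π' hπ' h
    obtain ⟨B, ρ, rfl, -, hB⟩ := hcons π hπ
    obtain ⟨B', ρ', rfl, -, hB'⟩ := hcons π' hπ'
    obtain ⟨hBB', rfl⟩ := List.cons.inj h
    rw [← erase_insert (notMem_of_forall_lt hB), hBB', erase_insert (notMem_of_forall_lt hB')]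
  have hdisj : Disjoint ((cuttings σ).image (List.cons {a}))
      ((cuttings σ).image (insertHead a)) := by
    simp only [disjoint_left, mem_image, not_exists, not_and, forall_exists_index, and_imp]
    rintro _ π - rfl π' hπ' h
    obtain ⟨B, ρ, rfl, ⟨b, hb⟩, hB⟩ := hcons π' hπ'
    have hba : b ∈ ({a} : Finset ℕ) := (List.cons.inj h).1 ▸ mem_insert_of_mem hb
    exact (hB b hb).ne (mem_singleton.1 hba)
  rw [cuttings, if_pos ha, sum_union hdisj, sum_image hinj,
    sum_image fun _ _ _ _ h => List.tail_eq_of_cons_eq h]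

end Cuttings

section WordGeneratingFunctions

variable {R : Type*} [CommRing R] (q : R) {a : ℕ} {σ : List ℕ}

/-- The generating function of the placements of the cuttings of `σ` into `x` cells, where each
block is weighted by its size. -/
def cardGF (σ : List ℕ) (x : ℕ) : R :=
  ∑ π ∈ cuttings σ, placements q (π.map card) x

/-- The generating function of the placements of the cuttings of `σ` into `x` cells, where the
major index is counted and each block has weight one. -/
def majGF (σ : List ℕ) (x : ℕ) : R :=
  ∑ π ∈ cuttings σ, q ^ maj π * placements q (List.replicate π.length 1) x

/-- The smallest exponent that occurs in `cardGF` and in `majGF`. -/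
def lowDegree : List ℕ → ℕ
  | [] => 0
  | a :: σ => lowDegree σ + if HeadLT σ a then 0 else σ.length

theorem cardGF_cons_zero (a : ℕ) (σ : List ℕ) : cardGF q (a :: σ) 0 = 0 := by
  refine sum_eq_zero fun π hπ => ?_
  obtain ⟨B, ρ, rfl⟩ := exists_cons_of_mem_cuttings_cons hπ
  rw [List.map_cons, placements_cons_zero]

theorem sum_placements_singleton_cons (a : ℕ) (σ : List ℕ) (x : ℕ) :
    ∑ π ∈ cuttings σ, placements q (({a} :: π).map card) (x + 1) =
      q ^ (σ.length + 1) * ∑ π ∈ cuttings σ, placements q (({a} :: π).map card) x +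
        q ^ σ.length * cardGF q σ x := by
  rw [cardGF, mul_sum, mul_sum, ← sum_add_distrib]
  refine sum_congr rfl fun π hπ => ?_
  rw [List.map_cons, placements_cons_succ, sum_map_card_of_mem_cuttings hπ, card_singleton,
    add_comm 1]

theorem sum_placements_insertHead (ha : HeadLT σ a) (x : ℕ) :
    ∑ π ∈ cuttings σ, placements q ((insertHead a π).map card) (x + 1) =
      q ^ (σ.length + 1) * ∑ π ∈ cuttings σ, placements q ((insertHead a π).map card) x +
        cardGF q σ (x + 1) - q ^ σ.length * cardGF q σ x := by
  rw [cardGF, cardGF, mul_sum, mul_sum, ← sum_add_distrib, ← sum_sub_distrib]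
  refine sum_congr rfl fun π hπ => ?_
  have hlen := sum_map_card_of_mem_cuttings hπ
  obtain ⟨B, ρ, rfl, -, hB⟩ := exists_cons_of_mem_cuttings ha hπ
  simp only [← hlen, insertHead, List.map_cons, List.sum_cons, placements_cons_succ,
    card_insert_of_notMem (notMem_of_forall_lt hB)]
  ring

theorem cardGF_cons_succ_of_not_headLT (ha : ¬HeadLT σ a) (x : ℕ) :
    cardGF q (a :: σ) (x + 1) =
      q ^ (σ.length + 1) * cardGF q (a :: σ) x + q ^ σ.length * cardGF q σ x := by
  rw [cardGF, cardGF, sum_cuttings_cons_of_not_headLT ha, sum_cuttings_cons_of_not_headLT ha,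
    sum_placements_singleton_cons]

theorem cardGF_cons_succ_of_headLT (ha : HeadLT σ a) (x : ℕ) :
    cardGF q (a :: σ) (x + 1) =
      q ^ (σ.length + 1) * cardGF q (a :: σ) x + cardGF q σ (x + 1) := by
  rw [cardGF, cardGF, sum_cuttings_cons_of_headLT ha, sum_cuttings_cons_of_headLT ha,
    sum_placements_singleton_cons, sum_placements_insertHead q ha]
  ring

theorem cardGF_eq (σ : List ℕ) (x : ℕ) :
    cardGF q σ x = q ^ lowDegree σ * qBinom q (x + des σ) σ.length := by
  induction σ generalizing x with
  | nil => simp [cardGF, cuttings, lowDegree]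
  | cons a σ ih =>
    induction x with
    | zero =>
      rw [cardGF_cons_zero, zero_add,
        qBinom_eq_zero_of_lt q (des_lt_length (List.cons_ne_nil a σ)), mul_zero]
    | succ x ihx =>
      by_cases ha : HeadLT σ a
      · rw [cardGF_cons_succ_of_headLT q ha, ihx, ih]
        simp only [des, lowDegree, ha, if_true, List.length_cons, ← add_assoc, add_zero,
          add_right_comm x 1, qBinom_succ_succ]
        ring
      · rw [cardGF_cons_succ_of_not_headLT q ha, ihx, ih]
        simp only [des, lowDegree, ha, if_false, List.length_cons, add_zero,
          add_right_comm x 1, qBinom_succ_succ]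
        ring

theorem majGF_cons_zero (a : ℕ) (σ : List ℕ) : majGF q (a :: σ) 0 = 0 := by
  refine sum_eq_zero fun π hπ => ?_
  obtain ⟨B, ρ, rfl⟩ := exists_cons_of_mem_cuttings_cons hπ
  rw [List.length_cons, List.replicate_succ, placements_cons_zero, mul_zero]

theorem sum_maj_singleton_cons (a : ℕ) (σ : List ℕ) (x : ℕ) :
    ∑ π ∈ cuttings σ, q ^ maj ({a} :: π) *
        placements q (List.replicate ({a} :: π).length 1) (x + 1) =
      ∑ π ∈ cuttings σ, q ^ maj ({a} :: π) *
        placements q (List.replicate ({a} :: π).length 1) x +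
          q ^ (x + des (a :: σ)) * majGF q σ x := by
  rw [majGF, mul_sum, ← sum_add_distrib]
  refine sum_congr rfl fun π hπ => ?_
  obtain ⟨hne, hword⟩ := mem_cuttings.1 hπ
  rw [maj_singleton_cons a hne, hword, List.length_cons, placements_replicate_one_succ]
  ring

theorem sum_maj_insertHead (ha : HeadLT σ a) (x : ℕ) :
    ∑ π ∈ cuttings σ, q ^ maj (insertHead a π) *
      placements q (List.replicate (insertHead a π).length 1) x = majGF q σ x := by
  refine sum_congr rfl fun π hπ => ?_
  obtain ⟨B, ρ, rfl, hne, hB⟩ := exists_cons_of_mem_cuttings ha hπ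
  rw [insertHead, maj_insert_cons hne hB, List.length_cons, List.length_cons]

theorem majGF_cons_succ_of_not_headLT (ha : ¬HeadLT σ a) (x : ℕ) :
    majGF q (a :: σ) (x + 1) = majGF q (a :: σ) x + q ^ (x + des σ) * majGF q σ x := by
  rw [majGF, majGF, sum_cuttings_cons_of_not_headLT ha, sum_cuttings_cons_of_not_headLT ha,
    sum_maj_singleton_cons, des, if_neg ha, add_zero]

theorem majGF_cons_succ_of_headLT (ha : HeadLT σ a) (x : ℕ) :
    majGF q (a :: σ) (x + 1) = majGF q (a :: σ) x + q ^ (x + des σ + 1) * majGF q σ x +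
      (majGF q σ (x + 1) - majGF q σ x) := by
  rw [majGF, majGF, sum_cuttings_cons_of_headLT ha, sum_cuttings_cons_of_headLT ha,
    sum_maj_singleton_cons, sum_maj_insertHead q ha, sum_maj_insertHead q ha, des, if_pos ha]
  ring

theorem majGF_eq (σ : List ℕ) (x : ℕ) :
    majGF q σ x = q ^ lowDegree σ * qBinom q (x + des σ) σ.length := by
  induction σ generalizing x with
  | nil => simp [majGF, cuttings, lowDegree, maj, word]
  | cons a σ ih =>
    induction x with
    | zero =>
      rw [majGF_cons_zero, zero_add,
        qBinom_eq_zero_of_lt q (des_lt_length (List.cons_ne_nil a σ)), mul_zero]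
    | succ x ihx =>
      by_cases ha : HeadLT σ a
      · rw [majGF_cons_succ_of_headLT q ha, ihx, ih, ih]
        simp only [des, lowDegree, ha, if_true, List.length_cons, ← add_assoc, add_zero,
          add_right_comm x 1]
        linear_combination -q ^ lowDegree σ * (qBinom_succ_succ' q (x + des σ + 1) σ.length +
          qBinom_succ_sub_qBinom_succ q (x + des σ) σ.length)
      · rw [majGF_cons_succ_of_not_headLT q ha, ihx, ih]
        simp only [des, lowDegree, ha, if_false, List.length_cons, add_zero, add_right_comm x 1]
        linear_combination
          -q ^ lowDegree σ * pow_mul_qBinom_succ_succ q (x + des σ) σ.length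

end WordGeneratingFunctions

section LastBlock

variable {x M : ℕ} {c : Fin x → Finset ℕ}

theorem getLast?_nonemptyBlocks {s : Fin x} (hs : (c s).Nonempty) (hlast : ∀ t, s < t → c t = ∅) :
    (nonemptyBlocks c).getLast? = some (c s) := by
  induction x with
  | zero => exact s.elim0
  | succ x ih =>
    induction c using Fin.consCases with
    | _ B c =>
      rw [nonemptyBlocks_cons]
      cases s using Fin.cases with
      | zero =>
        have hc : nonemptyBlocks c = [] :=
          nonemptyBlocks_eq_nil.2 (funext fun t => hlast t.succ t.succ_pos)
        rw [Fin.cons_zero] at hs ⊢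
        rw [if_pos hs, hc, List.getLast?_singleton]
      | succ s =>
        have hc := ih (c := c) hs fun t hst => hlast t.succ (Fin.succ_lt_succ_iff.2 hst)
        split_ifs
        · rw [List.getLast?_cons, hc, Option.getD_some, Fin.cons_succ]
        · rw [hc, Fin.cons_succ]

theorem zero_notMem_getLast?_nonemptyBlocks (hM : ∀ s, ∀ a ∈ c s, a < M) :
    (∀ B ∈ (nonemptyBlocks c).getLast?, 0 ∉ B) ↔
      profile c 1 = 0 ∨ profile c 1 < profile c M := by
  rcases ({s | (c s).Nonempty} : Finset (Fin x)).eq_empty_or_nonempty with hempty | hne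
  · have hc : c = fun _ => ∅ := by simpa [filter_eq_empty_iff, funext_iff] using hempty
    simp [hc, nonemptyBlocks, profile, endpoint]
  · obtain ⟨s, hs⟩ := exists_maximal hne
    have hlast : ∀ t, (c t).Nonempty → t ≤ s := fun t ht =>
      not_lt.1 (hs.not_gt (mem_filter_univ t |>.2 ht))
    obtain ⟨b, hb⟩ := (mem_filter_univ s).1 hs.1
    have hprofile : ∀ K, ∀ a ∈ c s, a < K → profile c K = s + 1 := by
      intro K a ha haK
      refine le_antisymm (profile_le_iff.2 fun t b hb _ => ?_) ?_
      · exact Nat.lt_succ_of_le (hlast t ⟨b, hb⟩)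
      · exact not_lt.1 fun h => (profile_le_iff.1 (Nat.lt_succ_iff.1 h) s a ha haK).false
    have hlt : 0 ∉ c s → profile c 1 < s + 1 := by
      refine fun h0 => Nat.lt_succ_of_le (profile_le_iff.2 fun t a ha ha1 => ?_)
      rw [Nat.lt_one_iff] at ha1
      subst ha1
      exact lt_of_le_of_ne (hlast t ⟨0, ha⟩) fun hts => h0 (Fin.ext hts ▸ ha)
    rw [getLast?_nonemptyBlocks ⟨b, hb⟩ fun t hst =>
        not_nonempty_iff_eq_empty.1 fun ht => (hlast t ht).not_gt hst, hprofile M b hb (hM s b hb)]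
    simp only [Option.mem_some_iff, forall_eq']
    by_cases h0 : 0 ∈ c s
    · simp [h0, hprofile 1 0 h0 one_pos]
    · simp [h0, hlt h0]

theorem zero_mem_getLast?_of_pairwise_ge {l : List ℕ} (hl : l.Pairwise (· ≥ ·)) :
    0 ∈ l.getLast? ↔ 0 ∈ l := by
  refine ⟨List.mem_of_getLast?, fun h0 => ?_⟩
  rcases l.eq_nil_or_concat' with rfl | ⟨l, b, rfl⟩
  · exact absurd h0 List.not_mem_nil
  · have hb : 0 ∈ l → b = 0 := fun h =>
      Nat.le_zero.1 ((List.pairwise_append.1 hl).2.2 0 h b (List.mem_singleton_self b))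
    rcases List.mem_append.1 h0 with h | h
    · simp [hb h]
    · simp [List.mem_singleton.1 h]

theorem zero_mem_getLast?_word {π : List (Finset ℕ)} (hπ : ∀ B ∈ π, B.Nonempty) :
    0 ∈ (word π).getLast? ↔ ∃ B ∈ π.getLast?, 0 ∈ B := by
  rcases π.eq_nil_or_concat' with rfl | ⟨π, B, rfl⟩
  · simp [word]
  · obtain ⟨b, hb⟩ := hπ B (by simp)
    have hsort : B.sort (fun a b => a ≥ b) ≠ [] := List.ne_nil_of_mem ((mem_sort _).2 hb)
    have hword : word (π ++ [B]) = word π ++ B.sort (fun a b => a ≥ b) := by simp [word]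
    rw [hword, List.getLast?_append_of_ne_nil _ hsort,
      zero_mem_getLast?_of_pairwise_ge (pairwise_sort _ _), mem_sort, List.getLast?_concat]
    simp

end LastBlock

section AllOP

variable {r m : ℕ} {β : Fin m → ℕ} {π : List (Finset ℕ)}

theorem lt_of_mem_content {a : ℕ} (ha : a ∈ content r β) : a < m + 1 := by
  rw [content, Multiset.mem_add, Multiset.mem_sum] at ha
  rcases ha with ha | ⟨i, -, ha⟩
  · exact Multiset.eq_of_mem_replicate ha ▸ m.succ_pos
  · exact Multiset.eq_of_mem_replicate ha ▸ Nat.succ_lt_succ i.isLt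

theorem length_le_sum_map_card (hπ : ∀ B ∈ π, B.Nonempty) : π.length ≤ (π.map card).sum := by
  simpa using List.length_le_sum_of_one_le (π.map card) (by simpa [Nat.succ_le_iff] using hπ)

theorem length_le_of_mem_OP {k : ℕ} (hπ : π ∈ OP r β k) : k ≤ (content r β).card := by
  obtain ⟨rfl, hne, hsum, -⟩ := hπ
  refine (length_le_sum_map_card hne).trans_eq ?_
  rw [← hsum, ← Multiset.cardHom_apply, map_list_sum, List.map_map]
  rfl

/-- The extended ordered multiset partitions of the given content with any number of blocks. The
number of blocks is at most the number of letters. -/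
noncomputable def allOP (r : ℕ) {m : ℕ} (β : Fin m → ℕ) : Finset (List (Finset ℕ)) :=
  (range ((content r β).card + 1)).biUnion fun k => (OP_finite r β k).toFinset

theorem mem_allOP : π ∈ allOP r β ↔ (∀ B ∈ π, B.Nonempty) ∧
    (π.map Finset.val).sum = content r β ∧ ∀ B ∈ π.getLast?, 0 ∉ B := by
  simp only [allOP, mem_biUnion, Set.Finite.mem_toFinset]
  constructor
  · rintro ⟨k, -, -, hπ⟩
    exact hπ
  · intro hπ
    have hmem : π ∈ OP r β π.length := ⟨rfl, hπ⟩
    exact ⟨_, mem_range.2 (Nat.lt_succ_of_le (length_le_of_mem_OP hmem)), hmem⟩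

theorem sum_allOP {M : Type*} [AddCommMonoid M] (f : List (Finset ℕ) → M) :
    ∑ π ∈ allOP r β, f π =
      ∑ k ∈ range ((content r β).card + 1), ∑ π ∈ (OP_finite r β k).toFinset, f π := by
  refine sum_biUnion fun i _ j _ hij => disjoint_left.2 fun π hi hj => hij ?_
  rw [Set.Finite.mem_toFinset] at hi hj
  exact hi.1.symm.trans hj.1

theorem map_occupied (hπ : ∀ B ∈ π, B.Nonempty) :
    π.map occupied = List.replicate π.length 1 :=
  List.map_eq_replicate_iff.2 fun B hB => if_pos (hπ B hB)

theorem count_sum_val {x : ℕ} (c : Fin x → Finset ℕ) (a : ℕ) :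
    Multiset.count a (∑ s, (c s).val) = #{s | a ∈ c s} := by
  simp only [Multiset.count_sum', card_filter, Multiset.count_eq_of_nodup (c _).nodup, mem_val]

theorem nonemptyBlocks_mem_allOP {x : ℕ} {c : Fin x → Finset ℕ} :
    nonemptyBlocks c ∈ allOP r β ↔ c ∈ tuples (fun a => (content r β).count a) (m + 1) x ∧
      (profile c 1 = 0 ∨ profile c 1 < profile c (m + 1)) := by
  have htuples : (∑ s, (c s).val) = content r β ↔
      c ∈ tuples (fun a => (content r β).count a) (m + 1) x := by
    rw [mem_tuples]
    refine ⟨fun h => ⟨fun s a ha => ?_, fun a _ => by rw [← h, count_sum_val]⟩,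
      fun ⟨hlt, hcount⟩ => Multiset.ext.2 fun a => ?_⟩
    · exact lt_of_mem_content (h ▸ Multiset.mem_sum.2 ⟨s, mem_univ s, ha⟩)
    · rw [count_sum_val]
      rcases lt_or_ge a (m + 1) with ha | ha
      · exact hcount a ha
      · rw [Multiset.count_eq_zero_of_notMem fun h => (lt_of_mem_content h).not_ge ha,
          card_eq_zero, filter_eq_empty_iff]
        exact fun s _ h => (hlt s a h).not_ge ha
  rw [mem_allOP, sum_map_nonemptyBlocks rfl, htuples]
  refine (and_iff_right fun B hB => (mem_nonemptyBlocks.1 hB).2).trans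
    (and_congr_right fun hc => ?_)
  exact zero_notMem_getLast?_nonemptyBlocks (mem_tuples.1 hc).1

theorem coe_word (π : List (Finset ℕ)) : (word π : Multiset ℕ) = (π.map Finset.val).sum := by
  induction π with
  | nil => rfl
  | cons B π ih =>
    rw [word_cons, ← Multiset.coe_add, ih, sort_eq, List.map_cons, List.sum_cons]

theorem mem_allOP_iff_word : π ∈ allOP r β ↔ (∀ B ∈ π, B.Nonempty) ∧
    (word π : Multiset ℕ) = content r β ∧ 0 ∉ (word π).getLast? := by
  rw [mem_allOP, coe_word]
  refine and_congr_right fun hπ => and_congr_right fun _ => ?_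
  rw [zero_mem_getLast?_word hπ]
  push Not
  rfl

variable {R : Type*} [CommRing R] (q : R)

theorem sum_allOP_mul_placements {φ : Finset ℕ → ℕ} (hφ : φ ∅ = 0) (g : List (Finset ℕ) → R)
    (x : ℕ) :
    ∑ π ∈ allOP r β, g π * placements q (π.map φ) x =
      ∑ c ∈ tuples (fun a => (content r β).count a) (m + 1) x with
        profile c 1 = 0 ∨ profile c 1 < profile c (m + 1),
        g (nonemptyBlocks c) * q ^ position φ c := by
  rw [← sum_fiberwise_of_maps_to (t := allOP r β) (g := nonemptyBlocks) fun c hc =>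
    nonemptyBlocks_mem_allOP.2 (mem_filter.1 hc)]
  refine sum_congr rfl fun π hπ => ?_
  have hne := (mem_allOP.1 hπ).1
  rw [← sum_spreadings q hφ hne, mul_sum]
  refine sum_congr ?_ fun c hc => by rw [(mem_filter.1 hc).2]
  ext c
  rw [mem_filter, mem_filter, ← nonemptyBlocks_mem_allOP, mem_spreadings hne]
  exact (and_iff_right_of_imp fun h => h.symm ▸ hπ).symm

theorem sum_allOP_of_isInsertionStat {stat : List (Finset ℕ) → ℕ} {x : ℕ}
    (hstat : IsInsertionStat (shiftedStat stat : (Fin x → Finset ℕ) → ℕ)) :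
    ∑ π ∈ allOP r β, q ^ stat π * placements q (List.replicate π.length 1) x =
      ∑ π ∈ allOP r β, placements q (π.map card) x := by
  have hcard := sum_allOP_mul_placements (r := r) (β := β) q card_empty (fun _ => 1) x
  simp only [one_mul] at hcard
  rw [hcard, sum_congr rfl fun π hπ => by rw [← map_occupied (mem_allOP.1 hπ).1],
    sum_allOP_mul_placements q (φ := occupied) rfl, sum_filter, sum_filter]
  simpa only [ite_mul, one_mul, zero_mul, shiftedStat, pow_add] using
    hstat.sum_eq isInsertionStat_position_card (fun a => (content r β).count a) (m + 1) q
      fun p => if p 1 = 0 ∨ p 1 < p (m + 1) then 1 else 0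

theorem filter_word_eq_cuttings (hπ : π ∈ allOP r β) :
    {ρ ∈ allOP r β | word ρ = word π} = cuttings (word π) := by
  ext ρ
  rw [mem_filter, mem_cuttings, mem_allOP_iff_word]
  refine and_congr_left fun hword => ?_
  rw [hword]
  exact and_iff_left (mem_allOP_iff_word.1 hπ).2

theorem sum_allOP_maj (x : ℕ) :
    ∑ π ∈ allOP r β, q ^ maj π * placements q (List.replicate π.length 1) x =
      ∑ π ∈ allOP r β, placements q (π.map card) x := by
  have hword : ∀ π ∈ allOP r β, word π ∈ (allOP r β).image word :=
    fun π hπ => mem_image_of_mem word hπ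
  rw [← sum_fiberwise_of_maps_to hword, ← sum_fiberwise_of_maps_to hword]
  refine sum_congr rfl fun σ hσ => ?_
  obtain ⟨π, hπ, rfl⟩ := mem_image.1 hσ
  rw [filter_word_eq_cuttings hπ]
  exact (majGF_eq q (word π) x).trans (cardGF_eq q (word π) x).symm

theorem sum_D_mul_placements (stat : List (Finset ℕ) → ℕ) (r : ℕ) (β : Fin m → ℕ) (x : ℕ) :
    ∑ k ∈ range ((content r β).card + 1),
        D stat r β k * placements X (List.replicate k 1) x =
      ∑ π ∈ allOP r β, X ^ stat π * placements X (List.replicate π.length 1) x := by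
  rw [sum_allOP]
  refine sum_congr rfl fun k _ => ?_
  rw [D, sum_mul]
  exact sum_congr rfl fun π hπ => by rw [((Set.Finite.mem_toFinset _).1 hπ).1]

theorem D_eq_of_sum_allOP_eq {stat stat' : List (Finset ℕ) → ℕ}
    (h : ∀ x, ∑ π ∈ allOP r β, (X : ℤ[X]) ^ stat π * placements X (List.replicate π.length 1) x =
      ∑ π ∈ allOP r β, X ^ stat' π * placements X (List.replicate π.length 1) x) (k : ℕ) :
    D stat r β k = D stat' r β k := by
  rcases lt_or_ge k ((content r β).card + 1) with hk | hk
  · refine eq_of_sum_mul_eq_of_triangular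
      (P := fun k x => placements X (List.replicate k 1) x) ?_ ?_ (fun x => ?_) hk
    · intro k x hxk
      rw [placements_replicate_one, qBinom_eq_zero_of_lt _ hxk, mul_zero]
    · intro k
      rw [placements_replicate_one, qBinom_self, mul_one]
      exact pow_ne_zero _ X_ne_zero
    · rw [sum_D_mul_placements, sum_D_mul_placements, h]
  · have hempty : (OP_finite r β k).toFinset = ∅ := eq_empty_of_forall_notMem fun π hπ =>
      (length_le_of_mem_OP ((Set.Finite.mem_toFinset _).1 hπ)).not_gt hk
    rw [D, D, hempty, sum_empty, sum_empty]

end AllOP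

end ExtOMP

theorem mainTheorem4 (r : ℕ) {m : ℕ} (β : Fin m → ℕ) (k : ℕ) :
    ExtOMP.D ExtOMP.inv r β k = ExtOMP.D ExtOMP.maj r β k ∧
      ExtOMP.D ExtOMP.maj r β k = ExtOMP.D ExtOMP.dinv r β k := by
  have hinv := fun x : ℕ => ExtOMP.sum_allOP_of_isInsertionStat (r := r) (β := β)
    (Polynomial.X : Polynomial ℤ) (ExtOMP.isInsertionStat_shiftedStat_inv (x := x))
  have hdinv := fun x : ℕ => ExtOMP.sum_allOP_of_isInsertionStat (r := r) (β := β)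
    (Polynomial.X : Polynomial ℤ) (ExtOMP.isInsertionStat_shiftedStat_dinv (x := x))
  have hmaj := ExtOMP.sum_allOP_maj (r := r) (β := β) (Polynomial.X : Polynomial ℤ)
  exact ⟨ExtOMP.D_eq_of_sum_allOP_eq (fun x => (hinv x).trans (hmaj x).symm) k,
    ExtOMP.D_eq_of_sum_allOP_eq (fun x => (hmaj x).trans (hdinv x).symm) k⟩
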